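/- Multigraphs may have loops and parallel edges. A finite multigraph $G=(V,E)$ is $(2,0)$-tight if $|E|=2|V|$ and, for every nonempty $X\subseteq V$, the subgraph induced by $X$ has at most $2|X|$ edges. Let $\vec E$ be the set of triples $(e,v,w)$ where $e\in E$ is an edge with ends $v,w\in V$ (two triples for a non-loop, one for a loop). For a group $\Gamma$, a gain map is a map $\phi:\vec E\to\Gamma$ such that (i) $\phi(e,v,w)=\phi(e,w,v)^{-1}$ if $v\ne w$; (ii) $\phi(e,v,w)\ne\phi(e',v,w)$ for all distinct edges $e,e'$ with ends $v,w$ (including the case $v=w$); (iii) $\phi(e,v,v)\neq 1$ for every loop $e$. Let $\Gamma\le O(2)$ and $p:V\to\mathbb R^2$. A $\Gamma$-symmetric infinitesimal flex of $(G,\phi,p)$ is a map $u:V\to\mathbb R^2$ in the kernel of the orbit rigidity matrix, i.e. $$\langle p(v)-\gamma p(w),u(v)\rangle+\langle p(w)-\gamma^{-1}p(v),u(w)\rangle=0\quad\text{for every non-loop } (e,v,w)\in\vec E,\ \gamma=\phi(e,v,w),$$ $$\langle 2p(v)-\gamma p(v)-\gamma^{-1}p(v),u(v)\rangle=0\quad\text{for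 every loop } (e,v,v)\in\vec E,\ \gamma=\phi(e,v,v).$$ It is trivial if there are a skew-symmetric matrix $T$ and $x\in\mathbb R^2$ with $\gamma u(v)=T\gamma p(v)+x$ for all $v\in V$, $\gamma\in\Gamma$. The pair $(G,\phi)$ is $\Gamma$-symmetrically rigid in $\mathbb R^2$ if for some $p:V\to\mathbb R^2$ every $\Gamma$-symmetric infinitesimal flex of $(G,\phi,p)$ is trivial. A map $P:V'\times\Gamma\to\mathbb R^2$ ($V'$ a finite set) is $\Gamma$-symmetric if $P(v,\gamma)=\gamma P(v,1)$ for all $v\in V'$, $\gamma\in\Gamma$. Let $\operatorname{Isom}(\Gamma)$ be the closed subgroup of all isometries $g$ of $\mathbb R^2$ such that $g\circ P$ is $\Gamma$-symmetric for every $\Gamma$-symmetric $P$, and let $k(\Gamma)=\dim\operatorname{Isom}(\Gamma)$ be its dimension as a Lie group. **Theorem.** Let $\Gamma$ be a (finite or infinite) subgroup of $O(2)$ with $k(\Gamma)=0$ and $|\Gamma|\ge 6$, and let $G=(V,E)$ be a $(2,0)$-tight multigraph. Then there exists a gain map $\phi:\vec E\to\Gamma$ such that $(G,\phi)$ is $\Gamma$-symmetrically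 rigid in $\mathbb R^2$. -/

import Mathlib

open scoped Graph Matrix

noncomputable section

namespace GainRigidity

/-- Euclidean `d`-space. -/
abbrev Space (d : ℕ) : Type := EuclideanSpace ℝ (Fin d)

/-- The orthogonal group `O(d)`, as the group of linear isometries of `ℝᵈ`. -/
abbrev O (d : ℕ) : Type := Space d ≃ₗᵢ[ℝ] Space d

/-! ### Sparsity of multigraphs

Multigraphs (loops and parallel edges allowed) are Mathlib's `Graph α β`. -/

section Sparsity

variable {α β : Type*}

/-- `i_G(X)`: the number of edges of the subgraph of `G` induced by `X`. -/
def inducedEdgeCount (G : Graph α β) (X : Set α) : ℕ :=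
  {e : β | ∃ v ∈ X, ∃ w ∈ X, G.IsLink e v w}.ncard

/-- `(k, l)`-sparsity of a finite multigraph, in the range `l ≤ k`: `i_G(X) ≤ k|X| - l` for all
nonempty `X ⊆ V(G)`. -/
def IsSparse (k l : ℕ) (G : Graph α β) : Prop :=
  ∀ X : Set α, X ⊆ V(G) → X.Nonempty → (inducedEdgeCount G X : ℤ) ≤ k * X.ncard - l

/-- `(k, l)`-tightness of a finite multigraph, in the range `l ≤ k`: `(k, l)`-sparse and `|E| = k|V| - l`. -/
def IsTight (k l : ℕ) (G : Graph α β) : Prop :=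
  V(G).Finite ∧ E(G).Finite ∧ IsSparse k l G ∧
    (E(G).ncard : ℤ) = k * V(G).ncard - l

end Sparsity

/-! ### Gain maps -/

section Gain

variable {α β : Type*}

/-- The set of all ordered triples `(e, v, w)` where the edge `e` has ends `v` and `w`.
A non-loop gives two triples, a loop gives one. -/
def Darts (G : Graph α β) : Type _ := {t : β × α × α // G.IsLink t.1 t.2.1 t.2.2}

/-- The triple `(e, v, w)`. -/
def dart {G : Graph α β} {e : β} {v w : α} (h : G.IsLink e v w) : Darts G := ⟨(e, v, w), h⟩

/-- Gain maps: reversing a non-loop inverts the gain, distinct parallel edges (and distinct loops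
at a vertex) have distinct gains, and loops have nontrivial gains. -/
structure IsGainMap {Γ : Type*} [Group Γ] (G : Graph α β) (φ : Darts G → Γ) : Prop where
  symm : ∀ {e : β} {v w : α} (h : G.IsLink e v w), v ≠ w → φ (dart h) = (φ (dart h.symm))⁻¹
  parallel : ∀ {e e' : β} {v w : α} (h : G.IsLink e v w) (h' : G.IsLink e' v w),
    e ≠ e' → φ (dart h) ≠ φ (dart h')
  loop : ∀ {e : β} {v : α} (h : G.IsLink e v v), φ (dart h) ≠ 1

end Gain

/-! ### Symmetric rigidity of gain graphs, for a point group `Γ ≤ O(d)` -/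

section Rigidity

variable {d : ℕ} {α β : Type*}

/-- The rows of the orbit rigidity matrix `R(G, φ, p)` vanish on `u`. The row of a non-loop `e`
with ends `v, w` has the entries `p(v) - φ(e,v,w) p(w)` at `v` and `p(w) - φ(e,w,v) p(v)` at `w`;
the row of a loop at `v` with gain `γ` has the entries `2 p(v) - γ p(v) - γ⁻¹ p(v)` at `v`. -/
def IsOrbitFlex (Γ : Subgroup (O d)) (G : Graph α β) (φ : Darts G → Γ)
    (p u : V(G) → Space d) : Prop :=
  (∀ (e : β) (v w : V(G)) (h : G.IsLink e v w), v ≠ w →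
    inner ℝ (p v - (φ (dart h) : O d) (p w)) (u v) +
      inner ℝ (p w - (φ (dart h.symm) : O d) (p v)) (u w) = 0) ∧
  (∀ (e : β) (v : V(G)) (h : G.IsLink e v v),
    inner ℝ ((2 : ℝ) • p v - (φ (dart h) : O d) (p v) - ((φ (dart h))⁻¹ : O d) (p v)) (u v) = 0)

/-- The `Γ`-symmetric map `(v, γ) ↦ γ p(v)` on the vertices `V × Γ` of the covering graph. -/
def lift {V : Type*} (Γ : Subgroup (O d)) (p : V → Space d) : V × Γ → Space d :=
  fun x ↦ (x.2 : O d) (p x.1)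

/-- A velocity assignment `u` of a placement `P` is trivial if it is the restriction of an
infinitesimal isometry `y ↦ T y + x`, with `T` skew-symmetric. -/
def IsTrivialFlex {W : Type*} (P u : W → Space d) : Prop :=
  ∃ (T : Matrix (Fin d) (Fin d) ℝ) (x : Space d), Tᵀ = -T ∧
    ∀ a : W, u a = Matrix.toEuclideanLin T (P a) + x

/-- The orbit framework `(G, φ, p)` is `Γ`-symmetrically rigid: for every flex `u`, the
corresponding flex of the covering framework is trivial. -/
def IsRigidOrbitFramework (Γ : Subgroup (O d)) (G : Graph α β) (φ : Darts G → Γ)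
    (p : V(G) → Space d) : Prop :=
  ∀ u : V(G) → Space d, IsOrbitFlex Γ G φ p u → IsTrivialFlex (lift Γ p) (lift Γ u)

/-- The gain graph `(G, φ)` is `Γ`-symmetrically rigid in `ℝᵈ`. -/
def IsSymmetricallyRigid (Γ : Subgroup (O d)) (G : Graph α β) (φ : Darts G → Γ) : Prop :=
  ∃ p : V(G) → Space d, IsRigidOrbitFramework Γ G φ p

end Rigidity

/-! ### The isometries that preserve `Γ`-symmetry -/

section SymmetryPreserving

variable {d : ℕ}

/-- `Γ`-symmetric placements of the vertex set `V × Γ` of a covering graph. -/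
def IsSymmetricPlacement {V : Type*} (Γ : Subgroup (O d)) (P : V × Γ → Space d) : Prop :=
  ∀ (v : V) (γ : Γ), P (v, γ) = (γ : O d) (P (v, 1))

/-- `Isom(Γ)`: the group of isometries `g` of `ℝᵈ` such that `g ∘ P` is `Γ`-symmetric
for every `Γ`-symmetric `P`. -/
def Isom (Γ : Subgroup (O d)) : Subgroup (Space d ≃ᵢ Space d) where
  carrier := {g | ∀ (V : Type) [Finite V] (P : V × Γ → Space d),
    IsSymmetricPlacement Γ P → IsSymmetricPlacement Γ (g ∘ P)}
  one_mem' := fun _ _ _ hP ↦ hP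
  mul_mem' := fun {g h} hg hh V _ P hP ↦ hg V (h ∘ P) (hh V P hP)
  inv_mem' := by
    intro g hg V _ P hP v γ
    have key := hg V (fun x ↦ (x.2 : O d) (g⁻¹ (P (x.1, 1)))) (fun _ _ ↦ by simp) v γ
    simp only [Function.comp_apply, OneMemClass.coe_one, LinearIsometryEquiv.coe_one, id_eq,
      IsometryEquiv.apply_inv_self] at key
    simp only [Function.comp_apply]
    rw [hP v γ, ← key, IsometryEquiv.inv_apply_self]

/-- The Lie algebra of `Isom(Γ)`: the velocities `y ↦ T y + x` at time `0` of the one-parameter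
groups of isometries contained in `Isom(Γ)`. -/
def isomLieAlgebra (Γ : Subgroup (O d)) : Set (Matrix (Fin d) (Fin d) ℝ × Space d) :=
  {X | ∃ g : ℝ → Space d ≃ᵢ Space d, (∀ s t, g (s + t) = g s * g t) ∧ (∀ t, g t ∈ Isom Γ) ∧
    ∀ y, HasDerivAt (fun t ↦ g t y) (Matrix.toEuclideanLin X.1 y + X.2) 0}

/-- `k(Γ) = dim Isom(Γ)`. The dimension of the Lie group `Isom(Γ)` (a closed subgroup of
`Isom(ℝᵈ)`) is the dimension of its Lie algebra, which is a linear subspace; `Set.finrank` is the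
dimension of the linear span. -/
def k (Γ : Subgroup (O d)) : ℕ := Set.finrank ℝ (isomLieAlgebra Γ)

end SymmetryPreserving

end GainRigidity

end

/-! The orbit rigidity matrix of a $(2,0)$-tight graph is square, so it suffices to choose a
placement and gains that make it invertible; every flex is then zero. Hall's theorem gives a
bijection from edges to pairs (vertex, coordinate) that sends each edge to one of its ends. The
corresponding coordinate functionals on velocities have no common zero. They are exchanged one at a
time for rows of the orbit matrix. The exchange at an edge succeeds if the rows of that edge, over
all gains in Γ, vanish together only where its coordinate functional does. For points at distinct
positive positions on the x-axis, `eq_zero_of_orbitRow_eq_zero` gives this: three rotations and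
three reflections in Γ already force the velocity to vanish at both ends. They exist because
$k(\Gamma)=0$ forces a reflection into Γ, so at least half of the six or more elements are of each
kind. The conditions on parallel edges and loops come for free: an invertible matrix has neither
equal rows nor a zero row. -/

open GainRigidity

namespace GainRigidity

/-! ### Exchanging functionals one at a time -/

section Exchange

/-- If every functional `f e` vanishes where all the functionals `R e γ` vanish, and the `f e` have
no common zero, then one `R e (φ e)` can be picked for each `e` such that these have no common zero
either. -/
theorem exists_choice_injective {ι Γ W : Type*} [Finite ι] [AddCommGroup W] [Module ℝ W]
    [FiniteDimensional ℝ W] (hcard : Module.finrank ℝ W = Nat.card ι)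
    (R : ι → Γ → W →ₗ[ℝ] ℝ) (f : ι → W →ₗ[ℝ] ℝ)
    (hf : ∀ u, (∀ e, f e u = 0) → u = 0)
    (h : ∀ e u, (∀ γ, R e γ u = 0) → f e u = 0) :
    ∃ φ : ι → Γ, ∀ u, (∀ e, R e (φ e) u = 0) → u = 0 := by
  classical
  have := Fintype.ofFinite ι
  suffices H : ∀ A : Finset ι, ∃ g : ι → W →ₗ[ℝ] ℝ, (∀ e ∈ A, ∃ γ, g e = R e γ) ∧
      (∀ e ∉ A, g e = f e) ∧ ∀ u, (∀ e, g e u = 0) → u = 0 by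
    obtain ⟨g, hg, -, hg0⟩ := H Finset.univ
    choose φ hφ using fun e ↦ hg e (Finset.mem_univ e)
    exact ⟨φ, fun u hu ↦ hg0 u fun e ↦ by rw [hφ e, hu e]⟩
  intro A
  induction A using Finset.induction_on with
  | empty => exact ⟨f, by simp, by simp, hf⟩
  | insert a A ha ih =>
    obtain ⟨g, hgR, hgf, hg0⟩ := ih
    have hga : g a = f a := hgf a ha
    -- Dimension count: otherwise zeroing the `a`-th coordinate would leave an injective, hence
    -- surjective, map whose `a`-th coordinate is always 0.
    obtain ⟨u, hu0, hu⟩ : ∃ u, u ≠ 0 ∧ ∀ e, e ≠ a → g e u = 0 := by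
      by_contra! hcon
      have hinj : Function.Injective (LinearMap.pi (Function.update g a 0)) := by
        rw [injective_iff_map_eq_zero]
        intro u hu
        by_contra hu0
        obtain ⟨e, hea, he⟩ := hcon u hu0
        apply he
        simpa [hea] using congrFun hu e
      have hsurj := (LinearMap.injective_iff_surjective_of_finrank_eq_finrank
        (by rw [hcard, Module.finrank_pi, Nat.card_eq_fintype_card])).1 hinj
      obtain ⟨u, hu⟩ := hsurj (fun _ ↦ 1)
      simpa using congrFun hu a
    have hfu : f a u ≠ 0 := by
      intro h0
      refine hu0 (hg0 u fun e ↦ ?_)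
      by_cases hea : e = a
      · rw [hea, hga, h0]
      · exact hu e hea
    obtain ⟨γ, hγ⟩ : ∃ γ, R a γ u ≠ 0 := by
      by_contra! hcon
      exact hfu (h a u hcon)
    refine ⟨Function.update g a (R a γ), fun e he ↦ ?_, fun e he ↦ ?_, fun w hw ↦ ?_⟩
    · by_cases hea : e = a
      · subst hea
        exact ⟨γ, by simp⟩
      · obtain ⟨δ, hδ⟩ := hgR e (Finset.mem_of_mem_insert_of_ne he hea)
        exact ⟨δ, by simp [hea, hδ]⟩
    · rw [Finset.mem_insert, not_or] at he
      simp [he.1, hgf e he.2]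
    · have hRw : R a γ w = 0 := by simpa using hw a
      have hw' : ∀ e, e ≠ a → g e w = 0 := fun e he ↦ by simpa [he] using hw e
      -- The common kernel of the other functionals is a line: this combination is killed by `g a =
      -- f a` as well.
      have hlin : f a u • w - f a w • u = 0 := by
        refine hg0 _ fun e ↦ ?_
        by_cases hea : e = a
        · subst hea
          simp [hga, mul_comm]
        · simp [hw' e hea, hu e hea]
      have hfw : f a w = 0 := by
        have := congrArg (R a γ) hlin
        simpa [hRw, hγ] using this
      refine hg0 w fun e ↦ ?_
      by_cases hea : e = a
      · rw [hea, hga, hfw]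
      · exact hw' e hea

end Exchange

/-! ### Assigning edges to coordinates by Hall's theorem -/

section Orientation

variable {α β : Type*}

/-- In a `(2, 0)`-tight multigraph, the edges are in bijection with two copies of the vertex set,
such that each edge is assigned to one of its ends. -/
theorem IsTight.exists_bijective {G : Graph α β} (hG : IsTight 2 0 G) :
    ∃ f : E(G) → V(G) × Fin 2, Function.Bijective f ∧ ∀ e : E(G), G.Inc e (f e).1 := by
  classical
  obtain ⟨hV, hE, hs, ht⟩ := hG
  have := hV.fintype
  have := hE.fintype
  let t : E(G) → Finset (V(G) × Fin 2) := fun e ↦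
    Finset.univ.filter fun x : V(G) × Fin 2 ↦ G.Inc e x.1
  have hall : ∀ s : Finset E(G), s.card ≤ (s.biUnion t).card := by
    intro s
    obtain rfl | ⟨e₀, he₀⟩ := s.eq_empty_or_nonempty
    · simp
    -- The Hall neighbourhood of `s` is two copies of the set `X` of its ends. All of `s` is induced
    -- by `X`, so sparsity is exactly Hall's condition.
    let X : Finset V(G) := Finset.univ.filter fun v ↦ ∃ e ∈ s, G.Inc e.1 v.1
    have hX : s.biUnion t = X ×ˢ Finset.univ := by
      ext ⟨v, i⟩
      simp [t, X]
    rw [hX, Finset.card_product, Finset.card_univ, Fintype.card_fin]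
    let X' : Set α := (↑) '' (X : Set V(G))
    have hX'V : X' ⊆ V(G) := by
      rintro _ ⟨v, -, rfl⟩
      exact v.2
    have hmem : ∀ e ∈ s, ∀ v, G.Inc e.1 v → v ∈ X' := fun e he v hv ↦
      ⟨⟨v, hv.vertex_mem⟩, by simpa [X] using ⟨e.1, ⟨e.2, he⟩, hv⟩, rfl⟩
    have hne : X'.Nonempty := by
      obtain ⟨v, w, h⟩ := G.exists_isLink_of_mem_edgeSet e₀.2
      exact ⟨v, hmem e₀ he₀ v h.inc_left⟩
    have hcardX : X'.ncard = X.card := by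
      rw [Set.ncard_image_of_injective _ Subtype.val_injective, Set.ncard_coe_finset]
    have hle : s.card ≤ inducedEdgeCount G X' := by
      rw [← Set.ncard_coe_finset, ← Set.ncard_image_of_injective _ Subtype.val_injective]
      refine Set.ncard_le_ncard ?_ (hE.subset ?_)
      · rintro _ ⟨e, he, rfl⟩
        obtain ⟨v, w, h⟩ := G.exists_isLink_of_mem_edgeSet e.2
        exact ⟨v, hmem e he v h.inc_left, w, hmem e he w h.inc_right, h⟩
      · rintro e ⟨v, -, w, -, h⟩
        exact h.edge_mem
    have := hs X' hX'V hne
    rw [hcardX] at this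
    push_cast at this
    omega
  obtain ⟨f, hinj, hf⟩ := (Finset.all_card_le_biUnion_card_iff_exists_injective t).1 hall
  refine ⟨f, (Fintype.bijective_iff_injective_and_card f).2 ⟨hinj, ?_⟩, fun e ↦ ?_⟩
  · rw [Fintype.card_prod, Fintype.card_fin, ← Nat.card_eq_fintype_card,
      ← Nat.card_eq_fintype_card, Nat.card_coe_set_eq, Nat.card_coe_set_eq]
    push_cast at ht
    omega
  · simpa [t] using hf e

end Orientation

/-! ### Orthogonal maps of the plane and points of the circle -/

section Plane

/-- The isometry with matrix `[c, -s; s, c]`. -/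
def IsRotation (γ : O 2) (c s : ℝ) : Prop :=
  c ^ 2 + s ^ 2 = 1 ∧ ∀ x, γ x = !₂[c * x 0 - s * x 1, s * x 0 + c * x 1]

/-- The isometry with matrix `[c, s; s, -c]`. -/
def IsReflection (γ : O 2) (c s : ℝ) : Prop :=
  c ^ 2 + s ^ 2 = 1 ∧ ∀ x, γ x = !₂[c * x 0 + s * x 1, s * x 0 - c * x 1]

theorem inner_eq (x y : Space 2) : inner ℝ x y = x 0 * y 0 + x 1 * y 1 := by
  rw [PiLp.inner_apply, Fin.sum_univ_two]
  simp [mul_comm]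

theorem inner_inv_left (γ : O 2) (x y : Space 2) :
    inner ℝ ((γ⁻¹ : O 2) x) y = inner ℝ x (γ y) := by
  rw [← LinearIsometryEquiv.inner_map_map γ, LinearIsometryEquiv.inv_def,
    LinearIsometryEquiv.apply_symm_apply]

/-- The images `a`, `b` of the standard basis are orthonormal, so `b` is the quarter turn of `a`
times the determinant, whose sign separates the two cases. -/
theorem isRotation_or_isReflection (γ : O 2) :
    (∃ c s, IsRotation γ c s) ∨ ∃ c s, IsReflection γ c s := by
  have hx : ∀ x : Space 2, γ x = x 0 • γ !₂[1, 0] + x 1 • γ !₂[0, 1] := by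
    intro x
    rw [← map_smul, ← map_smul, ← map_add]
    congr 1
    ext i
    fin_cases i <;> simp
  have h1 := γ.inner_map_map !₂[1, 0] !₂[1, 0]
  have h2 := γ.inner_map_map !₂[0, 1] !₂[0, 1]
  have h3 := γ.inner_map_map !₂[1, 0] !₂[0, 1]
  generalize γ !₂[1, 0] = a at *
  generalize γ !₂[0, 1] = b at *
  simp only [inner_eq] at h1 h2 h3
  norm_num at h1 h2 h3
  have hd : (a 0 * b 1 - a 1 * b 0) ^ 2 = 1 := by
    linear_combination (b 0 ^ 2 + b 1 ^ 2) * h1 + h2 - (a 0 * b 0 + a 1 * b 1) * h3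
  have h4 : b 0 = - a 1 * (a 0 * b 1 - a 1 * b 0) := by
    linear_combination (-b 0) * h1 + a 0 * h3
  have h5 : b 1 = a 0 * (a 0 * b 1 - a 1 * b 0) := by
    linear_combination (-b 1) * h1 + a 1 * h3
  obtain hd | hd := (sq_eq_sq_iff_eq_or_eq_neg.1 (hd.trans (one_pow 2).symm))
  · rw [hd] at h4 h5
    refine Or.inl ⟨a 0, a 1, by linarith, fun x ↦ ?_⟩
    rw [hx]
    ext i
    fin_cases i <;> simp [h4, h5] <;> ring
  · rw [hd] at h4 h5
    refine Or.inr ⟨a 0, a 1, by linarith, fun x ↦ ?_⟩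
    rw [hx]
    ext i
    fin_cases i <;> simp [h4, h5] <;> ring

theorem IsReflection.mul_isRotation {γ δ : O 2} {c s c' s' : ℝ} (h : IsReflection γ c s)
    (h' : IsRotation δ c' s') :
    IsReflection (γ * δ) (c * c' + s * s') (s * c' - c * s') := by
  refine ⟨by linear_combination (c' ^ 2 + s' ^ 2) * h.1 + h'.1, fun x ↦ ?_⟩
  rw [LinearIsometryEquiv.coe_mul, Function.comp_apply, h'.2, h.2]
  ext i
  fin_cases i <;> simp <;> ring

theorem IsReflection.mul_isReflection {γ δ : O 2} {c s c' s' : ℝ} (h : IsReflection γ c s)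
    (h' : IsReflection δ c' s') :
    IsRotation (γ * δ) (c * c' + s * s') (s * c' - c * s') := by
  refine ⟨by linear_combination (c' ^ 2 + s' ^ 2) * h.1 + h'.1, fun x ↦ ?_⟩
  rw [LinearIsometryEquiv.coe_mul, Function.comp_apply, h'.2, h.2]
  ext i
  fin_cases i <;> simp <;> ring

/-- An affine function that vanishes at three points of the unit circle is zero. -/
theorem eq_zero_of_three_circle_points {a b d : ℝ} {c s : Fin 3 → ℝ}
    (hcs : ∀ i, c i ^ 2 + s i ^ 2 = 1) (hinj : ∀ i j, c i = c j → s i = s j → i = j)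
    (h : ∀ i, a * c i + b * s i = d) : a = 0 ∧ b = 0 ∧ d = 0 := by
  suffices hab : a = 0 ∧ b = 0 by
    refine ⟨hab.1, hab.2, ?_⟩
    rw [← h 0, hab.1, hab.2]
    ring
  by_contra hab
  have hpos : a ^ 2 + b ^ 2 ≠ 0 := by
    intro h0
    exact hab ⟨by nlinarith [sq_nonneg a, sq_nonneg b], by nlinarith [sq_nonneg a, sq_nonneg b]⟩
  -- A line meets a circle at most twice: the coordinate along the line determines the point, and
  -- its square is the same at all three points.
  have hsq : ∀ i, (a * s i - b * c i) ^ 2 = a ^ 2 + b ^ 2 - d ^ 2 := fun i ↦ by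
    linear_combination (a ^ 2 + b ^ 2) * hcs i - (a * c i + b * s i + d) * h i
  have heq : ∀ i j, a * s i - b * c i = a * s j - b * c j → i = j := fun i j hij ↦ by
    have hc : (a ^ 2 + b ^ 2) * (c i - c j) = 0 := by
      linear_combination a * (h i - h j) - b * hij
    have hs : (a ^ 2 + b ^ 2) * (s i - s j) = 0 := by
      linear_combination b * (h i - h j) + a * hij
    exact hinj i j (sub_eq_zero.1 ((mul_eq_zero.1 hc).resolve_left hpos))
      (sub_eq_zero.1 ((mul_eq_zero.1 hs).resolve_left hpos))
  have h01 := sq_eq_sq_iff_eq_or_eq_neg.1 ((hsq 0).trans (hsq 1).symm)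
  have h02 := sq_eq_sq_iff_eq_or_eq_neg.1 ((hsq 0).trans (hsq 2).symm)
  obtain h01 | h01 := h01
  · exact absurd (heq 0 1 h01) (by decide)
  obtain h02 | h02 := h02
  · exact absurd (heq 0 2 h02) (by decide)
  · exact absurd (heq 1 2 (by linarith)) (by decide)

end Plane

/-! ### Rotations and reflections in Γ -/

section PointGroup

/-- The rotation of the plane by the angle `t`. -/
noncomputable def rot (t : ℝ) : Space 2 ≃ᵢ Space 2 where
  toFun x := !₂[Real.cos t * x 0 - Real.sin t * x 1, Real.sin t * x 0 + Real.cos t * x 1]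
  invFun x := !₂[Real.cos t * x 0 + Real.sin t * x 1, -Real.sin t * x 0 + Real.cos t * x 1]
  left_inv x := by
    ext i
    fin_cases i <;> simp
    · linear_combination (x 0) * Real.sin_sq_add_cos_sq t
    · linear_combination (x 1) * Real.sin_sq_add_cos_sq t
  right_inv x := by
    ext i
    fin_cases i <;> simp
    · linear_combination (x 0) * Real.sin_sq_add_cos_sq t
    · linear_combination (x 1) * Real.sin_sq_add_cos_sq t
  isometry_toFun := by
    refine Isometry.of_dist_eq fun x y ↦ ?_
    rw [EuclideanSpace.dist_eq, EuclideanSpace.dist_eq, Fin.sum_univ_two, Fin.sum_univ_two]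
    congr 1
    simp only [Real.dist_eq, sq_abs]
    simp
    linear_combination ((x 0 - y 0) ^ 2 + (x 1 - y 1) ^ 2) * Real.sin_sq_add_cos_sq t

theorem rot_apply (t : ℝ) (x : Space 2) : rot t x =
    !₂[Real.cos t * x 0 - Real.sin t * x 1, Real.sin t * x 0 + Real.cos t * x 1] := rfl

theorem hasDerivAt_rot (y : Space 2) :
    HasDerivAt (fun t ↦ rot t y)
      (Matrix.toEuclideanLin !![(0 : ℝ), -1; 1, 0] y + 0) 0 := by
  have hrot : (fun t ↦ rot t y) =
      fun t ↦ Real.cos t • y + Real.sin t • (!₂[-y 1, y 0] : Space 2) := by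
    ext t i
    rw [rot_apply]
    fin_cases i <;> simp <;> ring
  have hderiv : Matrix.toEuclideanLin !![(0 : ℝ), -1; 1, 0] y + 0 =
      -Real.sin 0 • y + Real.cos 0 • (!₂[-y 1, y 0] : Space 2) := by
    ext i
    fin_cases i <;> simp [Matrix.toLpLin_apply, dotProduct]
  rw [hrot, hderiv]
  exact ((Real.hasDerivAt_cos 0).smul_const y).add ((Real.hasDerivAt_sin 0).smul_const _)

/-- A group of rotations commutes with every rotation, so the one-parameter group `rot` would lie in
`Isom Γ` and its nonzero velocity in the Lie algebra. -/
theorem exists_isReflection (Γ : Subgroup (O 2)) (hk : k Γ = 0) :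
    ∃ σ ∈ Γ, ∃ c s, IsReflection σ c s := by
  by_contra! hcon
  have hrot : ∀ γ ∈ Γ, ∃ c s, IsRotation γ c s := fun γ hγ ↦
    (isRotation_or_isReflection γ).resolve_right fun ⟨c, s, h⟩ ↦ hcon γ hγ c s h
  have hmem : ((!![(0 : ℝ), -1; 1, 0], 0) : Matrix (Fin 2) (Fin 2) ℝ × Space 2) ∈
      isomLieAlgebra Γ := by
    refine ⟨rot, fun s t ↦ ?_, fun t V _ P hP v γ ↦ ?_, hasDerivAt_rot⟩
    · ext x i
      rw [IsometryEquiv.mul_apply, rot_apply, rot_apply, rot_apply]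
      fin_cases i <;> simp [Real.cos_add, Real.sin_add] <;> ring
    · obtain ⟨c, s, h⟩ := hrot γ.1 γ.2
      simp only [Function.comp_apply]
      rw [hP v γ, h.2, h.2, rot_apply, rot_apply]
      ext i
      fin_cases i <;> simp <;> ring
  have hspan : Submodule.span ℝ (isomLieAlgebra Γ) = ⊥ := Submodule.finrank_eq_zero.1 hk
  have h0 := Submodule.subset_span (R := ℝ) hmem
  rw [hspan, SetLike.mem_coe, Submodule.mem_bot] at h0
  have := congrFun (congrFun (congrArg Prod.fst h0) 1) 0
  simp at this

theorem exists_three_of_le_encard {X : Type*} {S : Set X} (h : 3 ≤ S.encard) :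
    ∃ x : Fin 3 → X, Function.Injective x ∧ ∀ i, x i ∈ S := by
  obtain ⟨T, hTS, hT⟩ := Set.exists_subset_encard_eq h
  obtain ⟨a, b, c, hab, hac, hbc, rfl⟩ := Set.encard_eq_three.1 hT
  refine ⟨![a, b, c], fun i j hij ↦ ?_, fun i ↦ hTS ?_⟩
  · fin_cases i <;> fin_cases j <;> simp_all [eq_comm]
  · fin_cases i <;> simp

/-- Left multiplication by one reflection injects rotations into reflections and conversely, so the
two kinds are equinumerous. -/
theorem exists_three_rotations_reflections (Γ : Subgroup (O 2)) (hk : k Γ = 0)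
    (hcard : 6 ≤ ENat.card Γ) :
    (∃ (γ : Fin 3 → Γ) (c s : Fin 3 → ℝ), (∀ i, IsRotation (γ i) (c i) (s i)) ∧
      ∀ i j, c i = c j → s i = s j → i = j) ∧
    ∃ (γ : Fin 3 → Γ) (c s : Fin 3 → ℝ), (∀ i, IsReflection (γ i) (c i) (s i)) ∧
      ∀ i j, c i = c j → s i = s j → i = j := by
  obtain ⟨σ, hσ, c₀, s₀, hσr⟩ := exists_isReflection Γ hk
  let A : Set Γ := {γ | ∃ c s, IsRotation γ c s}
  let B : Set Γ := {γ | ∃ c s, IsReflection γ c s}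
  have hinj : Function.Injective fun γ : Γ ↦ (⟨σ, hσ⟩ : Γ) * γ := mul_right_injective _
  have hAB : A.encard ≤ B.encard := by
    refine Set.encard_le_encard_of_injOn (f := fun γ : Γ ↦ (⟨σ, hσ⟩ : Γ) * γ) ?_ hinj.injOn
    rintro γ ⟨c, s, h⟩
    exact ⟨_, _, hσr.mul_isRotation h⟩
  have hBA : B.encard ≤ A.encard := by
    refine Set.encard_le_encard_of_injOn (f := fun γ : Γ ↦ (⟨σ, hσ⟩ : Γ) * γ) ?_ hinj.injOn
    rintro γ ⟨c, s, h⟩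
    exact ⟨_, _, hσr.mul_isReflection h⟩
  have heq : A.encard = B.encard := le_antisymm hAB hBA
  have hU : A ∪ B = Set.univ := Set.eq_univ_of_forall fun γ ↦ isRotation_or_isReflection γ
  have h6 : 6 ≤ A.encard + B.encard := by
    refine le_trans ?_ (Set.encard_union_le A B)
    rw [hU, Set.encard_univ]
    exact hcard
  have hA : 3 ≤ A.encard := by
    by_contra! hlt
    rw [← heq] at h6
    lift A.encard to ℕ using hlt.ne_top with n
    norm_cast at h6 hlt
    omega
  have hB : 3 ≤ B.encard := heq ▸ hA
  constructor
  · obtain ⟨γ, hγ, hm⟩ := exists_three_of_le_encard hA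
    choose c s h using hm
    refine ⟨γ, c, s, h, fun i j hc hs ↦ hγ (Subtype.ext (LinearIsometryEquiv.ext fun x ↦ ?_))⟩
    rw [(h i).2, (h j).2, hc, hs]
  · obtain ⟨γ, hγ, hm⟩ := exists_three_of_le_encard hB
    choose c s h using hm
    refine ⟨γ, c, s, h, fun i j hc hs ↦ hγ (Subtype.ext (LinearIsometryEquiv.ext fun x ↦ ?_))⟩
    rw [(h i).2, (h j).2, hc, hs]

end PointGroup

/-! ### Rows of the orbit matrix for points on the x-axis -/

section Rows

variable {V : Type*}

/-- The row of the orbit rigidity matrix of an edge from `v` to `w` with gain `γ`, as a linear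
functional. For `v = w` this is the row of a loop. -/
noncomputable def orbitRow (p : V → Space 2) (v w : V) (γ : O 2) : (V → Space 2) →ₗ[ℝ] ℝ :=
  (innerₗ (Space 2) (p v - γ (p w))).comp (LinearMap.proj v) +
    (innerₗ (Space 2) (p w - γ⁻¹ (p v))).comp (LinearMap.proj w)

theorem orbitRow_apply (p u : V → Space 2) (v w : V) (γ : O 2) :
    orbitRow p v w γ u = inner ℝ (p v - γ (p w)) (u v) + inner ℝ (p w - γ⁻¹ (p v)) (u w) :=
  rfl

theorem orbitRow_swap (p : V → Space 2) (v w : V) (γ : O 2) :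
    orbitRow p w v γ⁻¹ = orbitRow p v w γ := by
  ext u
  rw [orbitRow_apply, orbitRow_apply, inv_inv, add_comm]

theorem orbitRow_self_one (p : V → Space 2) (v : V) : orbitRow p v v 1 = 0 := by
  ext u
  simp [orbitRow_apply]

theorem orbitRow_self (p u : V → Space 2) (v : V) (γ : O 2) :
    orbitRow p v v γ u = inner ℝ ((2 : ℝ) • p v - γ (p v) - γ⁻¹ (p v)) (u v) := by
  rw [orbitRow_apply, ← inner_add_left]
  congr 1
  module

/-- If the rows of an edge for all gains in `Γ` vanish on `u`, then `u` vanishes at both ends. -/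
theorem eq_zero_of_orbitRow_eq_zero (Γ : Subgroup (O 2)) (hk : k Γ = 0)
    (hcard : 6 ≤ ENat.card Γ) {r : V → ℝ} (hr : ∀ v, 0 < r v) (hinj : Function.Injective r)
    {v w : V} {u : V → Space 2}
    (h : ∀ γ : Γ, orbitRow (fun v ↦ !₂[r v, 0]) v w γ u = 0) : u v = 0 ∧ u w = 0 := by
  obtain ⟨⟨γ, c, s, hγ, hcs⟩, ⟨δ, c', s', hδ, hcs'⟩⟩ :=
    exists_three_rotations_reflections Γ hk hcard
  -- The row is affine in the matrix entries `(c, s)`, so three points of the circle kill all its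
  -- coefficients. Rotations and reflections differ only in the sign of `r v * u w 1`; together they
  -- separate the second coordinates.
  have h1 : ∀ i, (r w * u v 0 + r v * u w 0) * c i + (r w * u v 1 - r v * u w 1) * s i =
      r v * u v 0 + r w * u w 0 := by
    intro i
    have := h (γ i)
    rw [orbitRow_apply, inner_sub_left, inner_sub_left, inner_inv_left, (hγ i).2, (hγ i).2] at this
    simp [inner_eq] at this
    linear_combination -this
  have h2 : ∀ i, (r w * u v 0 + r v * u w 0) * c' i + (r w * u v 1 + r v * u w 1) * s' i =
      r v * u v 0 + r w * u w 0 := by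
    intro i
    have := h (δ i)
    rw [orbitRow_apply, inner_sub_left, inner_sub_left, inner_inv_left, (hδ i).2, (hδ i).2] at this
    simp [inner_eq] at this
    linear_combination -this
  obtain ⟨ha, hb, hd⟩ := eq_zero_of_three_circle_points (fun i ↦ (hγ i).1) hcs h1
  obtain ⟨-, hb', -⟩ := eq_zero_of_three_circle_points (fun i ↦ (hδ i).1) hcs' h2
  have hv1 : u v 1 = 0 := by
    have : r w * u v 1 = 0 := by linarith
    exact (mul_eq_zero.1 this).resolve_left (hr w).ne'
  have hw1 : u w 1 = 0 := by
    have : r v * u w 1 = 0 := by linarith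
    exact (mul_eq_zero.1 this).resolve_left (hr v).ne'
  have h0 : u v 0 = 0 ∧ u w 0 = 0 := by
    by_cases hvw : v = w
    · subst hvw
      have : r v * u v 0 = 0 := by linarith
      have := (mul_eq_zero.1 this).resolve_left (hr v).ne'
      exact ⟨this, this⟩
    -- Up to sign, the determinant of the system `ha`, `hd` in the first coordinates.
    · have hne : r v ^ 2 - r w ^ 2 ≠ 0 := by
        rw [sub_ne_zero]
        intro hsq
        exact hvw (hinj ((sq_eq_sq₀ (hr v).le (hr w).le).1 hsq))
      have hv : (r v ^ 2 - r w ^ 2) * u v 0 = 0 := by linear_combination r v * hd - r w * ha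
      have hw : (r v ^ 2 - r w ^ 2) * u w 0 = 0 := by linear_combination r v * ha - r w * hd
      exact ⟨(mul_eq_zero.1 hv).resolve_left hne, (mul_eq_zero.1 hw).resolve_left hne⟩
  constructor
  · ext i
    fin_cases i
    · exact h0.1
    · exact hv1
  · ext i
    fin_cases i
    · exact h0.2
    · exact hw1

end Rows

/-! ### Invertibility of the orbit matrix and the theorem -/

section Assembly

variable {α β : Type*}

theorem exists_placement_gains (Γ : Subgroup (O 2)) (hk : k Γ = 0) (hcard : 6 ≤ ENat.card Γ)
    {G : Graph α β} (hG : IsTight 2 0 G) {src tgt : E(G) → V(G)}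
    (hl : ∀ e : E(G), G.IsLink e (src e) (tgt e)) :
    ∃ (p : V(G) → Space 2) (ψ : E(G) → Γ),
      Function.Bijective fun u e ↦ orbitRow p (src e) (tgt e) (ψ e) u := by
  classical
  obtain ⟨f, hf, hinc⟩ := hG.exists_bijective
  have := hG.1.fintype
  have := hG.2.1.fintype
  -- Adding 1 to the index keeps the positions positive as well as distinct.
  let r : V(G) → ℝ := fun v ↦ (Fintype.equivFin V(G) v : ℕ) + 1
  have hr : ∀ v, 0 < r v := fun v ↦ by positivity
  have hrinj : Function.Injective r := fun v w h ↦ by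
    simpa [r, Fin.val_inj] using h
  have hfin : Module.finrank ℝ (V(G) → Space 2) = Nat.card E(G) := by
    rw [Nat.card_congr (Equiv.ofBijective f hf), Module.finrank_pi_fintype]
    simp
  obtain ⟨ψ, hψ⟩ := exists_choice_injective hfin
    (fun e (γ : Γ) ↦ orbitRow (fun v ↦ !₂[r v, 0]) (src e) (tgt e) γ)
    (fun e ↦ (EuclideanSpace.proj (f e).2 : Space 2 →L[ℝ] ℝ).toLinearMap.comp
      (LinearMap.proj (f e).1))
    (fun u hu ↦ by
      ext v i
      obtain ⟨e, he⟩ := hf.2 (v, i)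
      simpa [he] using hu e)
    (fun e u h ↦ by
      obtain ⟨hs, ht⟩ := eq_zero_of_orbitRow_eq_zero Γ hk hcard hr hrinj h
      have hu : u (f e).1 = 0 := by
        obtain hv | hv := (hinc e).eq_or_eq_of_isLink (hl e)
        · rw [← hs, Subtype.ext hv]
        · rw [← ht, Subtype.ext hv]
      simp [hu])
  refine ⟨fun v ↦ !₂[r v, 0], ψ, ?_⟩
  let L : (V(G) → Space 2) →ₗ[ℝ] (E(G) → ℝ) :=
    LinearMap.pi fun e ↦ orbitRow (fun v ↦ !₂[r v, 0]) (src e) (tgt e) (ψ e)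
  have hinj : Function.Injective L := by
    rw [injective_iff_map_eq_zero]
    exact fun u hu ↦ hψ u fun e ↦ congrFun hu e
  exact ⟨hinj, (LinearMap.injective_iff_surjective_of_finrank_eq_finrank
    (by rw [hfin, Module.finrank_pi, Nat.card_eq_fintype_card])).1 hinj⟩

end Assembly

end GainRigidity

theorem mainTheorem3 {α β : Type*} (Γ : Subgroup (GainRigidity.O 2))
    (hk : GainRigidity.k Γ = 0) (hcard : 6 ≤ ENat.card Γ)
    (G : Graph α β) (hG : GainRigidity.IsTight 2 0 G) :
    ∃ φ : GainRigidity.Darts G → Γ,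
      GainRigidity.IsGainMap G φ ∧ GainRigidity.IsSymmetricallyRigid Γ G φ := by
  classical
  have hex : ∀ e : E(G), ∃ v w : V(G), G.IsLink e v w := fun e ↦ by
    obtain ⟨v, w, h⟩ := G.exists_isLink_of_mem_edgeSet e.2
    exact ⟨⟨v, h.left_mem⟩, ⟨w, h.right_mem⟩, h⟩
  choose src tgt hl using hex
  obtain ⟨p, ψ, hinj, hsurj⟩ := exists_placement_gains Γ hk hcard hG hl
  -- The gain is `ψ` along the chosen orientation and its inverse against it; a loop always takes
  -- the first branch.
  let φ : Darts G → Γ := fun t ↦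
    if t.1.2.1 = src ⟨t.1.1, t.2.edge_mem⟩ then ψ ⟨t.1.1, t.2.edge_mem⟩
    else (ψ ⟨t.1.1, t.2.edge_mem⟩)⁻¹
  have hsymm : ∀ {e : β} {v w : α} (h : G.IsLink e v w), v ≠ w →
      φ (dart h) = (φ (dart h.symm))⁻¹ := by
    intro e v w h hvw
    obtain ⟨h1, h2⟩ | ⟨h1, h2⟩ := h.eq_and_eq_or_eq_and_eq (hl ⟨e, h.edge_mem⟩)
    · simp [φ, dart, ← h1, hvw.symm]
    · simp [φ, dart, ← h2, hvw]
  have hrow : ∀ (e : β) (v w : V(G)) (h : G.IsLink e v w),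
      orbitRow p v w (φ (dart h)) =
        orbitRow p (src ⟨e, h.edge_mem⟩) (tgt ⟨e, h.edge_mem⟩) (ψ ⟨e, h.edge_mem⟩) := by
    intro e v w h
    obtain ⟨h1, h2⟩ | ⟨h1, h2⟩ := h.eq_and_eq_or_eq_and_eq (hl ⟨e, h.edge_mem⟩)
    · rw [← Subtype.ext h1, ← Subtype.ext h2]
      simp [φ, dart, ← h1]
    · by_cases hvw : v = w
      · subst hvw
        rw [← Subtype.ext h1, ← Subtype.ext h2]
        simp [φ, dart, ← h2]
      · have hvw' : (v : α) ≠ w := fun h ↦ hvw (Subtype.ext h)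
        rw [← Subtype.ext h1, ← Subtype.ext h2]
        simp [φ, dart, ← h2, hvw', orbitRow_swap]
  refine ⟨φ, ⟨hsymm, ?_, ?_⟩, p, ?_⟩
  -- Equal gains would give equal rows, which cannot take the values 1 and 0 on the same `u`.
  · intro e e' v w h h' hne heq
    obtain ⟨u, hu⟩ := hsurj (Pi.single ⟨e, h.edge_mem⟩ 1)
    have h1 := congrFun hu ⟨e, h.edge_mem⟩
    have h2 := congrFun hu ⟨e', h'.edge_mem⟩
    simp only [← hrow _ ⟨v, h.left_mem⟩ ⟨w, h.right_mem⟩ h] at h1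
    simp only [← hrow _ ⟨v, h.left_mem⟩ ⟨w, h.right_mem⟩ h', ← heq] at h2
    rw [h1, Pi.single_eq_same, Pi.single_eq_of_ne (by simpa using hne.symm)] at h2
    exact one_ne_zero h2
  -- A loop of gain 1 would have a zero row, which cannot take the value 1.
  · intro e v h h1
    obtain ⟨u, hu⟩ := hsurj (fun _ ↦ 1)
    have h2 := congrFun hu ⟨e, h.edge_mem⟩
    simp only [← hrow _ ⟨v, h.left_mem⟩ ⟨v, h.left_mem⟩ h, h1] at h2
    simp [orbitRow_self_one] at h2
  · intro u hu
    have hu0 : u = 0 := by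
      refine hinj (funext fun e ↦ ?_)
      simp only [map_zero]
      rw [← hrow e (src e) (tgt e) (hl e)]
      by_cases hst : src e = tgt e
      · have hloop : ∀ (w : V(G)) (hw : G.IsLink e (src e) w), src e = w →
            orbitRow p (src e) w (φ (dart hw)) u = 0 := by
          rintro w hw rfl
          rw [orbitRow_self]
          exact hu.2 e _ hw
        exact hloop _ (hl e) hst
      · have hst' : (src e : α) ≠ tgt e := fun h ↦ hst (Subtype.ext h)
        have := hu.1 e _ _ (hl e) hst
        rw [hsymm (hl e).symm hst'.symm] at this
        simpa [orbitRow_apply] using this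
    subst hu0
    exact ⟨0, 0, by simp, fun a ↦ by simp [lift]⟩
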